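/- Let $E$ be a real Banach lattice, and let $E^*$ be its norm dual with the dual order, which is again a Banach lattice. A sequence $(x_n)$ in a Banach lattice is called disjoint if $|x_m|\wedge|x_n|=0$ for all $m\ne n$. * A norm bounded subset $A$ of a Banach lattice $F$ is *almost limited* if for every disjoint weak$^*$ null sequence $(f_n)$ in $F^*$ one has $\sup_{x\in A}|f_n(x)|\to 0$. * A norm bounded subset $A$ of a Banach lattice $F$ is *almost Dunford–Pettis* if for every disjoint weakly null sequence $(f_n)$ in $F^*$ one has $\sup_{x\in A}|f_n(x)|\to 0$. * A norm bounded subset $B$ of $E^*$ is an *almost $L$-set* if for every disjoint weakly null sequence $(x_n)$ in $E$ one has $\sup_{f\in B}|f(x_n)|\to 0$. **Theorem.** Suppose that the norm of $E^*$ is order continuous, that is, $\inf_{f\in D}\|f\|=0$ for every nonempty downward directed set $D\subseteq E^*$ with $\inf D=0$. Then for every subset $A$ of $E^*$ the following are equivalent: $A$ is almost limited in $E^*$; $A$ is almost Dunford–Pettis in $E^*$; $A$ is an almost $L$-set. That is, these three classes of subsets of $E^*$ coincide. -/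

import Mathlib

open Filter Topology

/-! ## The dual of a normed vector lattice as a normed vector lattice -/

namespace DualLattice

section Norm

variable {E : Type*} [NormedAddCommGroup E] [Lattice E] [IsOrderedAddMonoid E] [HasSolidNorm E]

theorem norm_le_of_le {x y : E} (hx : 0 ≤ x) (hxy : x ≤ y) : ‖x‖ ≤ ‖y‖ :=
  norm_le_norm_of_abs_le_abs (by rwa [abs_of_nonneg hx, abs_of_nonneg (hx.trans hxy)])

end Norm

section Construction

variable {E : Type*} [NormedAddCommGroup E] [NormedSpace ℝ E] [Lattice E]

/-- The set of values of `f` on the order interval `[0, x]`. -/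
def intervalValues (f : StrongDual ℝ E) (x : E) : Set ℝ := f '' Set.Icc 0 x

/-- The supremum of `f` on the order interval `[0, x]`; for `0 ≤ x` this is the value at `x` of the
positive part of `f`. -/
noncomputable def conePos (f : StrongDual ℝ E) (x : E) : ℝ := sSup (intervalValues f x)

theorem conePos_le (f : StrongDual ℝ E) {x : E} (hx : 0 ≤ x) {r : ℝ}
    (h : ∀ y, 0 ≤ y → y ≤ x → f y ≤ r) : conePos f x ≤ r := by
  refine csSup_le ⟨f 0, 0, ⟨le_rfl, hx⟩, rfl⟩ ?_
  rintro _ ⟨y, hy, rfl⟩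
  exact h y hy.1 hy.2

/-- The dual order: `f ≤ g` if and only if `f x ≤ g x` for all `x ≥ 0`. -/
instance instLE : LE (StrongDual ℝ E) := ⟨fun f g => ∀ x : E, 0 ≤ x → f x ≤ g x⟩

theorem le_def {f g : StrongDual ℝ E} : f ≤ g ↔ ∀ x : E, 0 ≤ x → f x ≤ g x := Iff.rfl

variable [IsOrderedAddMonoid E]

noncomputable instance instPartialOrder : PartialOrder (StrongDual ℝ E) where
  le_refl _ _ _ := le_rfl
  le_trans _ _ _ h₁ h₂ x hx := (h₁ x hx).trans (h₂ x hx)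
  le_antisymm f g h₁ h₂ := by
    have key : ∀ x : E, 0 ≤ x → f x = g x := fun x hx => le_antisymm (h₁ x hx) (h₂ x hx)
    ext x
    rw [← posPart_sub_negPart x, map_sub, map_sub, key _ (posPart_nonneg x),
      key _ (negPart_nonneg x)]

instance instIsOrderedAddMonoid : IsOrderedAddMonoid (StrongDual ℝ E) where
  add_le_add_left f g h k x hx := by
    simpa using h x hx

instance instIsOrderedModule : IsOrderedModule ℝ (StrongDual ℝ E) where
  smul_le_smul_of_nonneg_left c hc f g h x hx := by
    simpa using mul_le_mul_of_nonneg_left (h x hx) hc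
  smul_le_smul_of_nonneg_right f hf c d h x hx := by
    simpa using mul_le_mul_of_nonneg_right h (hf x hx)

variable [HasSolidNorm E]

theorem intervalValues_le (f : StrongDual ℝ E) (x : E) {r : ℝ} (hr : r ∈ intervalValues f x) :
    r ≤ ‖f‖ * ‖x‖ := by
  obtain ⟨y, hy, rfl⟩ := hr
  exact (le_abs_self _).trans ((f.le_opNorm y).trans
    (mul_le_mul_of_nonneg_left (norm_le_of_le hy.1 hy.2) (norm_nonneg f)))

theorem bddAbove_intervalValues (f : StrongDual ℝ E) (x : E) : BddAbove (intervalValues f x) :=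
  ⟨_, fun _ hr => intervalValues_le f x hr⟩

theorem le_conePos (f : StrongDual ℝ E) {x y : E} (hy : 0 ≤ y) (hyx : y ≤ x) :
    f y ≤ conePos f x :=
  le_csSup (bddAbove_intervalValues f x) ⟨y, ⟨hy, hyx⟩, rfl⟩

theorem conePos_nonneg (f : StrongDual ℝ E) {x : E} (hx : 0 ≤ x) : 0 ≤ conePos f x := by
  simpa using le_conePos f le_rfl hx

theorem conePos_bound (f : StrongDual ℝ E) {x : E} (hx : 0 ≤ x) : conePos f x ≤ ‖f‖ * ‖x‖ :=
  conePos_le f hx fun y hy hyx => intervalValues_le f x ⟨y, ⟨hy, hyx⟩, rfl⟩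

theorem conePos_add (f : StrongDual ℝ E) {x y : E} (hx : 0 ≤ x) (hy : 0 ≤ y) :
    conePos f (x + y) = conePos f x + conePos f y := by
  apply le_antisymm
  · refine conePos_le f (add_nonneg hx hy) fun z hz hzxy => ?_
    have h₁ : f (z ⊓ x) ≤ conePos f x := le_conePos f (le_inf hz hx) inf_le_right
    have h₂ : f (z - z ⊓ x) ≤ conePos f y := by
      refine le_conePos f (sub_nonneg.2 inf_le_left) ?_
      rw [sub_le_comm]
      exact le_inf (sub_le_self _ hy) (sub_le_iff_le_add.2 hzxy)
    rw [map_sub] at h₂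
    linarith
  · rw [← le_sub_iff_add_le]
    refine conePos_le f hx fun a ha hax => ?_
    rw [le_sub_comm]
    refine conePos_le f hy fun b hb hby => ?_
    have := le_conePos f (add_nonneg ha hb) (add_le_add hax hby)
    rw [map_add] at this
    linarith

theorem conePos_sub_eq (f : StrongDual ℝ E) {a b c d : E} (ha : 0 ≤ a) (hb : 0 ≤ b) (hc : 0 ≤ c)
    (hd : 0 ≤ d) (h : a - b = c - d) :
    conePos f a - conePos f b = conePos f c - conePos f d := by
  have h' : a + d = c + b := by rw [← sub_eq_sub_iff_add_eq_add]; exact h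
  have := congrArg (conePos f) h'
  rw [conePos_add f ha hd, conePos_add f hc hb] at this
  linarith

/-- The positive part of `f`, as an additive map: `x ↦ sup f[0, x⁺] - sup f[0, x⁻]`. -/
noncomputable def posHom (f : StrongDual ℝ E) : E →+ ℝ :=
  AddMonoidHom.mk' (fun x => conePos f x⁺ - conePos f x⁻) fun x y => by
    have h := conePos_sub_eq f (posPart_nonneg (x + y)) (negPart_nonneg (x + y))
      (add_nonneg (posPart_nonneg x) (posPart_nonneg y))
      (add_nonneg (negPart_nonneg x) (negPart_nonneg y)) (by
        rw [add_sub_add_comm, posPart_sub_negPart, posPart_sub_negPart, posPart_sub_negPart])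
    rw [conePos_add f (posPart_nonneg x) (posPart_nonneg y),
      conePos_add f (negPart_nonneg x) (negPart_nonneg y)] at h
    linarith

theorem posHom_bound (f : StrongDual ℝ E) (x : E) : ‖posHom f x‖ ≤ ‖f‖ * ‖x‖ := by
  have h₁ : ‖x⁺‖ ≤ ‖x‖ := by
    rw [← norm_abs_eq_norm x]
    exact norm_le_of_le (posPart_nonneg x) (by
      rw [← posPart_add_negPart x]; exact le_add_of_nonneg_right (negPart_nonneg x))
  have h₂ : ‖x⁻‖ ≤ ‖x‖ := by
    rw [← norm_abs_eq_norm x]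
    exact norm_le_of_le (negPart_nonneg x) (by
      rw [← posPart_add_negPart x]; exact le_add_of_nonneg_left (posPart_nonneg x))
  have h₃ := (conePos_bound f (posPart_nonneg x)).trans
    (mul_le_mul_of_nonneg_left h₁ (norm_nonneg f))
  have h₄ := (conePos_bound f (negPart_nonneg x)).trans
    (mul_le_mul_of_nonneg_left h₂ (norm_nonneg f))
  have h₅ := conePos_nonneg f (posPart_nonneg x)
  have h₆ := conePos_nonneg f (negPart_nonneg x)
  change |conePos f x⁺ - conePos f x⁻| ≤ _
  rw [abs_le]
  constructor <;> linarith

/-- The positive part of `f`, as a continuous linear functional. -/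
noncomputable def pos (f : StrongDual ℝ E) : StrongDual ℝ E :=
  (posHom f).toRealLinearMap (AddMonoidHomClass.continuous_of_bound (posHom f) ‖f‖ (posHom_bound f))

theorem pos_apply (f : StrongDual ℝ E) {x : E} (hx : 0 ≤ x) : pos f x = conePos f x := by
  change conePos f x⁺ - conePos f x⁻ = conePos f x
  have h0 : conePos f (0 : E) = 0 :=
    le_antisymm (by simpa using conePos_bound f (le_refl (0 : E))) (conePos_nonneg f le_rfl)
  rw [posPart_eq_self.2 hx, negPart_eq_zero.2 hx, h0, sub_zero]

theorem le_pos (f : StrongDual ℝ E) : f ≤ pos f := fun x hx => by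
  rw [pos_apply f hx]; exact le_conePos f hx le_rfl

theorem pos_nonneg (f : StrongDual ℝ E) : 0 ≤ pos f := fun x hx => by
  rw [pos_apply f hx]; exact conePos_nonneg f hx

theorem pos_le {f g : StrongDual ℝ E} (hfg : f ≤ g) (hg : 0 ≤ g) : pos f ≤ g := fun x hx => by
  rw [pos_apply f hx]
  refine conePos_le f hx fun y hy hyx => (hfg y hy).trans ?_
  have := hg (x - y) (sub_nonneg.2 hyx)
  rw [map_sub] at this
  simpa using this

/-- The dual of a normed vector lattice is a vector lattice for the dual order, with the
Riesz–Kantorovich lattice operations `f ⊔ g = g + (f - g)⁺` and `f ⊓ g = f - (f - g)⁺`. -/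
noncomputable instance instLattice : Lattice (StrongDual ℝ E) where
  __ := instPartialOrder
  sup f g := g + pos (f - g)
  inf f g := f - pos (f - g)
  le_sup_left f g := by simpa [add_comm] using add_le_add_left (le_pos (f - g)) g
  le_sup_right f g := le_add_of_nonneg_right (pos_nonneg (f - g))
  sup_le f g h hf hg := by
    have := pos_le (sub_le_sub_right hf g) (sub_nonneg.2 hg)
    rwa [le_sub_iff_add_le'] at this
  inf_le_left f g := sub_le_self _ (pos_nonneg (f - g))
  inf_le_right f g := by
    rw [sub_le_comm]; exact le_pos (f - g)
  le_inf f g h hg hh := by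
    rw [le_sub_comm]
    exact pos_le (sub_le_sub_left hh g) (sub_nonneg.2 hg)

theorem abs_apply_le (f : StrongDual ℝ E) (x : E) : |f x| ≤ |f| |x| := by
  have h₁ := le_abs_self f x⁺ (posPart_nonneg x)
  have h₂ := le_abs_self f x⁻ (negPart_nonneg x)
  have h₃ := neg_le_abs f x⁺ (posPart_nonneg x)
  have h₄ := neg_le_abs f x⁻ (negPart_nonneg x)
  have hx : f x = f x⁺ - f x⁻ := by rw [← map_sub, posPart_sub_negPart]
  have hax : |f| |x| = |f| x⁺ + |f| x⁻ := by rw [← map_add, posPart_add_negPart]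
  rw [_root_.neg_apply] at h₃ h₄
  rw [hx, hax, abs_le]
  constructor <;> linarith

theorem abs_apply_le_norm (f : StrongDual ℝ E) {x : E} (hx : 0 ≤ x) : |f| x ≤ ‖f‖ * ‖x‖ := by
  change (-f + pos (f - -f)) x ≤ _
  rw [_root_.add_apply, pos_apply _ hx, ← le_sub_iff_add_le']
  refine conePos_le _ hx fun y hy hyx => ?_
  have h₁ : |y + y - x| ≤ |x| := by
    rw [abs_of_nonneg hx, abs_le']
    constructor
    · rw [sub_le_iff_le_add]; exact add_le_add hyx hyx
    · rw [neg_sub]; exact sub_le_self _ (add_nonneg hy hy)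
  have h₂ := (le_abs_self _).trans ((f.le_opNorm (y + y - x)).trans
    (mul_le_mul_of_nonneg_left (norm_le_norm_of_abs_le_abs h₁) (norm_nonneg f)))
  rw [map_sub, map_add] at h₂
  simp only [_root_.sub_apply, _root_.neg_apply]
  linarith

/-- The dual norm is a lattice norm. -/
instance instHasSolidNorm : HasSolidNorm (StrongDual ℝ E) where
  solid f g h := by
    refine f.opNorm_le_bound (norm_nonneg g) fun x => ?_
    calc ‖f x‖ ≤ |f| |x| := abs_apply_le f x
      _ ≤ |g| |x| := h _ (abs_nonneg x)
      _ ≤ ‖g‖ * ‖|x|‖ := abs_apply_le_norm g (abs_nonneg x)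
      _ = ‖g‖ * ‖x‖ := by rw [norm_abs_eq_norm]

end Construction

end DualLattice

/-! ## Order continuous norms and the three classes of sets -/

section Classes

/-- A sequence in a vector lattice is disjoint if `|x m| ⊓ |x n| = 0` for all `m ≠ n`. -/
def IsDisjointSeq {F : Type*} [AddCommGroup F] [Lattice F] (x : ℕ → F) : Prop :=
  ∀ m n, m ≠ n → |x m| ⊓ |x n| = 0

/-- The sequence `x` converges weakly to zero. -/
def IsWeaklyNull {X : Type*} [NormedAddCommGroup X] [NormedSpace ℝ X] (x : ℕ → X) : Prop :=
  Tendsto (fun n => toWeakSpace ℝ X (x n)) atTop (𝓝 0)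

/-- The sequence `f` of functionals converges to zero in the weak-* topology. -/
def IsWeakStarNull {X : Type*} [NormedAddCommGroup X] [NormedSpace ℝ X]
    (f : ℕ → StrongDual ℝ X) : Prop :=
  Tendsto (fun n => StrongDual.toWeakDual (f n)) atTop (𝓝 0)

/-- The norm is order continuous: `inf {‖x‖ : x ∈ D} = 0` for every nonempty downward directed set
`D` with `inf D = 0`. -/
def HasOrderContinuousNorm (F : Type*) [NormedAddCommGroup F] [Lattice F] : Prop :=
  ∀ D : Set F, D.Nonempty → DirectedOn (· ≥ ·) D → IsGLB D 0 → IsGLB (norm '' D) 0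

variable {F : Type*} [NormedAddCommGroup F] [NormedSpace ℝ F] [Lattice F] [IsOrderedAddMonoid F]
  [HasSolidNorm F]

/-- A norm bounded set `A` is almost limited if every disjoint weak-* null sequence of functionals
converges to zero uniformly on `A`. -/
def IsAlmostLimited (A : Set F) : Prop :=
  Bornology.IsBounded A ∧ ∀ f : ℕ → StrongDual ℝ F, IsDisjointSeq f → IsWeakStarNull f →
    TendstoUniformlyOn (fun n x => f n x) 0 atTop A

/-- A norm bounded set `A` is almost Dunford–Pettis if every disjoint weakly null sequence of
functionals converges to zero uniformly on `A`. -/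
def IsAlmostDunfordPettis (A : Set F) : Prop :=
  Bornology.IsBounded A ∧ ∀ f : ℕ → StrongDual ℝ F, IsDisjointSeq f → IsWeaklyNull f →
    TendstoUniformlyOn (fun n x => f n x) 0 atTop A

/-- A norm bounded set `B` of functionals is an almost L-set if every disjoint weakly null sequence
of vectors converges to zero uniformly on `B`. -/
def IsAlmostLSet (B : Set (StrongDual ℝ F)) : Prop :=
  Bornology.IsBounded B ∧ ∀ x : ℕ → F, IsDisjointSeq x → IsWeaklyNull x →
    TendstoUniformlyOn (fun n (f : StrongDual ℝ F) => f (x n)) 0 atTop B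

end Classes

/-! ### Disjoint positive vectors -/

section DisjointVectors

variable {F : Type*} [AddCommGroup F] [Lattice F] [IsOrderedAddMonoid F]

/-! Weakly null functionals are weak-* null, and the embedding of `E` into its bidual preserves
disjointness and weak nullity; this gives the two easy implications, without order continuity. The
content is the passage from almost L-sets back to almost limited sets.

Suppose `φ n` in `E**` are disjoint and weak-* null, yet `|φ n (f n)| ≥ ε` with `f n ∈ A`. Order
continuity of the norm of `E*` makes `|φ n|` weak-* null as well (`tendsto_apply_zero_of_disjoint`).
So late `|φ n|` nearly vanish on each fixed `|f m|`, and a subsequence of `|f n|` can be cut down to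
disjoint `g k` on which the `|φ n|` stay large (`exists_disjoint_le_of_tendsto_zero`). Then `‖g k‖`
is bounded below, and a subsequence of `g` stays large along a bounded disjoint sequence in `E`
(`exists_disjoint_of_le_norm`). Such sequences are weakly null, again by order continuity, which
contradicts the L-set property.

The engine is `disjointification`: subtract a large multiple of the earlier terms and a small
multiple of a vector dominating every term up to a scalar. A functional nearly vanishing on the
earlier terms loses little. -/

theorem add_inf_eq_zero {a b c : F} (ha : 0 ≤ a) (hb : 0 ≤ b) (hc : 0 ≤ c) (hac : a ⊓ c = 0)
    (hbc : b ⊓ c = 0) : (a + b) ⊓ c = 0 := by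
  refine le_antisymm ?_ (le_inf (add_nonneg ha hb) hc)
  calc (a + b) ⊓ c ≤ a ⊓ c + b ⊓ c := by
        rw [add_inf, inf_add, inf_add]
        refine le_inf (le_inf inf_le_left (inf_le_right.trans (le_add_of_nonneg_right hb)))
          (le_inf (inf_le_right.trans (le_add_of_nonneg_left ha))
            (inf_le_right.trans (le_add_of_nonneg_left hc)))
    _ = 0 := by rw [hac, hbc, add_zero]

theorem sum_inf_eq_zero {ι : Type*} (s : Finset ι) {f : ι → F} {c : F} (hf : ∀ i, 0 ≤ f i)
    (hc : 0 ≤ c) (h : ∀ i ∈ s, f i ⊓ c = 0) : (∑ i ∈ s, f i) ⊓ c = 0 := by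
  classical
  induction s using Finset.induction_on with
  | empty => simpa using hc
  | insert a s ha ih =>
    rw [Finset.sum_insert ha]
    exact add_inf_eq_zero (hf a) (Finset.sum_nonneg fun i _ => hf i) hc
      (h a (Finset.mem_insert_self a s)) (ih fun i hi => h i (Finset.mem_insert_of_mem hi))

/-- The partial sums of a disjoint sequence of positive vectors obey every common upper bound of
its terms. -/
theorem sum_range_le_of_disjoint {f : ℕ → F} {g : F} (hf : ∀ i, 0 ≤ f i)
    (hd : Pairwise fun m n => f m ⊓ f n = 0) (hg : ∀ i, f i ≤ g) (n : ℕ) :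
    ∑ i ∈ Finset.range n, f i ≤ g := by
  induction n with
  | zero => simpa using (hf 0).trans (hg 0)
  | succ n ih =>
    have h0 : (∑ i ∈ Finset.range n, f i) ⊓ f n = 0 :=
      sum_inf_eq_zero _ hf (hf n) fun i hi => hd (Finset.mem_range.1 hi).ne
    rw [Finset.sum_range_succ, ← inf_add_sup (∑ i ∈ Finset.range n, f i), h0, zero_add]
    exact sup_le ih (hg n)

theorem inf_eq_zero_of_le {a b c d : F} (ha : 0 ≤ a) (hb : 0 ≤ b) (hac : a ≤ c) (hbd : b ≤ d)
    (h : c ⊓ d = 0) : a ⊓ b = 0 :=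
  le_antisymm ((inf_le_inf hac hbd).trans h.le) (le_inf ha hb)

theorem isDisjointSeq_of_nonneg {x : ℕ → F} (hx : ∀ n, 0 ≤ x n)
    (hd : Pairwise fun m n => x m ⊓ x n = 0) : IsDisjointSeq x := fun m n hmn => by
  rw [abs_of_nonneg (hx m), abs_of_nonneg (hx n)]
  exact hd hmn

theorem IsDisjointSeq.of_abs_le {x y : ℕ → F} (hx : IsDisjointSeq x) (h : ∀ n, |y n| ≤ |x n|) :
    IsDisjointSeq y := fun m n hmn =>
  inf_eq_zero_of_le (abs_nonneg _) (abs_nonneg _) (h m) (h n) (hx m n hmn)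

end DisjointVectors

/-! ### Order continuous norms and disjointification -/

section NormedLattice

variable {F : Type*} [NormedAddCommGroup F] [NormedSpace ℝ F] [Lattice F] [IsOrderedAddMonoid F]
  [IsOrderedModule ℝ F] [HasSolidNorm F]

theorem nonpos_of_forall_nsmul_le {w p : F} (h : ∀ n : ℕ, n • w ≤ p) : w ≤ 0 := by
  have hlim : Tendsto (fun n : ℕ => ((n : ℝ) + 1)⁻¹ • p) atTop (𝓝 ((0 : ℝ) • p)) := by
    refine Tendsto.smul_const ?_ p
    simpa using tendsto_one_div_add_atTop_nhds_zero_nat (𝕜 := ℝ)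
  rw [zero_smul] at hlim
  refine ge_of_tendsto' hlim fun n => ?_
  have hn : (0 : ℝ) < (n : ℝ) + 1 := by positivity
  have := smul_le_smul_of_nonneg_left (h (n + 1)) (inv_nonneg.2 hn.le)
  rwa [← Nat.cast_smul_eq_nsmul ℝ, smul_smul, Nat.cast_add, Nat.cast_one,
    inv_mul_cancel₀ hn.ne', one_smul] at this

/-- Any upper bound `u` can be lowered to the upper bound `u - w`; iterating from `f` keeps `k • w ≤
f - s 0` for all `k`, and the Archimedean property applies. -/
theorem le_of_forall_upperBound_sub {s : ℕ → F} {f w : F} (hs : ∀ n, s n ≤ f)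
    (hw : ∀ u, (∀ n, s n ≤ u) → ∀ n, w ≤ u - s n) : w ≤ 0 := by
  have key : ∀ k : ℕ, ∀ n, s n ≤ f - k • w := by
    intro k
    induction k with
    | zero => simpa using hs
    | succ k ih =>
      intro n
      have := hw _ ih n
      rw [le_sub_comm] at this
      rwa [succ_nsmul, ← sub_sub]
  exact nonpos_of_forall_nsmul_le (p := f - s 0) fun k => le_sub_comm.1 (key k 0)

/-- In a normed lattice with order continuous norm, increasing order bounded sequences are
eventually within any given distance of one of their terms. -/
theorem HasOrderContinuousNorm.exists_norm_sub_lt (h : HasOrderContinuousNorm F) {s : ℕ → F} {f : F}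
    (hs : Monotone s) (hf : ∀ n, s n ≤ f) {ε : ℝ} (hε : 0 < ε) :
    ∃ n, ∀ m, n ≤ m → ‖s m - s n‖ < ε := by
  -- Differences of upper bounds and terms stand in for `sup s - s n`, so the supremum need not
  -- exist.
  have hglb := h {d | ∃ u n, (∀ k, s k ≤ u) ∧ d = u - s n} ⟨_, f, 0, hf, rfl⟩ ?_ ?_
  · obtain ⟨_, ⟨d, ⟨u, n, hu, rfl⟩, rfl⟩, -, hlt⟩ := hglb.exists_between hε
    refine ⟨n, fun m hm => (DualLattice.norm_le_of_le (sub_nonneg.2 (hs hm)) ?_).trans_lt hlt⟩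
    exact sub_le_sub_right (hu m) _
  · rintro _ ⟨u, n, hu, rfl⟩ _ ⟨v, m, hv, rfl⟩
    refine ⟨u ⊓ v - s (max n m), ⟨_, _, fun k => le_inf (hu k) (hv k), rfl⟩, ?_, ?_⟩
    · exact sub_le_sub inf_le_left (hs (le_max_left _ _))
    · exact sub_le_sub inf_le_right (hs (le_max_right _ _))
  · refine ⟨?_, fun w hw => le_of_forall_upperBound_sub hf fun u hu n => hw ⟨u, n, hu, rfl⟩⟩
    rintro _ ⟨u, n, hu, rfl⟩
    exact sub_nonneg.2 (hu n)

/-- Order bounded disjoint sequences are norm null if the norm is order continuous. -/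
theorem HasOrderContinuousNorm.tendsto_zero_of_disjoint (h : HasOrderContinuousNorm F) {f : ℕ → F}
    {g : F} (hf : ∀ n, 0 ≤ f n) (hd : Pairwise fun m n => f m ⊓ f n = 0) (hg : ∀ n, f n ≤ g) :
    Tendsto f atTop (𝓝 0) := by
  rw [Metric.tendsto_atTop]
  intro ε hε
  obtain ⟨N, hN⟩ := h.exists_norm_sub_lt (s := fun n => ∑ i ∈ Finset.range n, f i)
    (monotone_nat_of_le_succ fun n => by
      rw [Finset.sum_range_succ]; exact le_add_of_nonneg_right (hf n))
    (sum_range_le_of_disjoint hf hd hg) (half_pos hε)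
  refine ⟨N, fun n hn => ?_⟩
  have h₁ := hN n hn
  have h₂ := hN (n + 1) (hn.trans n.le_succ)
  rw [Finset.sum_range_succ] at h₂
  rw [dist_zero_right]
  calc ‖f n‖ = ‖(∑ i ∈ Finset.range n, f i + f n - ∑ i ∈ Finset.range N, f i) -
        (∑ i ∈ Finset.range n, f i - ∑ i ∈ Finset.range N, f i)‖ := by congr 1; abel
    _ ≤ _ := norm_sub_le _ _
    _ < ε := by linarith

/-- Since `b - K⁻¹ • a = -K⁻¹ • (a - K • b)` and `K⁻¹ ≤ 1`, `q` lies below the negative part of `a -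
K • b` and `p` below its positive part. -/
theorem posPart_smul_sub_disjoint {p q a b : F} {K : ℝ} (hK : 1 ≤ K) (hp : 0 ≤ p) (hq : 0 ≤ q)
    (hpa : p ≤ (a - K • b)⁺) (hqb : q ≤ (b - K⁻¹ • a)⁺) : q ⊓ p = 0 := by
  have hK0 : 0 < K := one_pos.trans_le hK
  refine inf_eq_zero_of_le hq hp ?_ hpa
    ((inf_comm _ _).trans (posPart_inf_negPart_eq_zero (a - K • b)))
  refine hqb.trans (sup_le ?_ (negPart_nonneg _))
  have h₁ : b - K⁻¹ • a = K⁻¹ • (-(a - K • b)) := by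
    rw [neg_sub, smul_sub, smul_smul, inv_mul_cancel₀ hK0.ne', one_smul]
  have h₂ := smul_le_smul_of_nonneg_left (neg_le_negPart (a - K • b)) (inv_nonneg.2 hK0.le)
  rw [h₁]
  refine h₂.trans ?_
  have h₃ := smul_le_smul_of_nonneg_right (inv_le_one_of_one_le₀ hK) (negPart_nonneg (a - K • b))
  rwa [one_smul] at h₃

/-- The `n`-th term of the disjoint sequence obtained from `v` by cutting off multiples of the
previous terms and of a control vector `z`. -/
noncomputable def disjointification (v : ℕ → F) (z : F) (L : ℕ → ℝ) (ε : ℝ) (n : ℕ) : F :=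
  (v n - (L n / ε) • ∑ m ∈ Finset.range n, v m - ε • z)⁺

variable {v : ℕ → F} {z : F} {L : ℕ → ℝ} {ε : ℝ}

theorem disjointification_nonneg (n : ℕ) : 0 ≤ disjointification v z L ε n := posPart_nonneg _

theorem disjointification_le (hv : ∀ n, 0 ≤ v n) (hz : 0 ≤ z) (hL : ∀ n, 0 ≤ L n) (hε : 0 ≤ ε)
    (n : ℕ) : disjointification v z L ε n ≤ v n := by
  refine sup_le ?_ (hv n)
  refine (sub_le_self _ (smul_nonneg hε hz)).trans (sub_le_self _ ?_)
  exact smul_nonneg (div_nonneg (hL n) hε) (Finset.sum_nonneg fun i _ => hv i)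

/-- For `m < n` take `K = L n / ε`: the later term has lost `K • v m`, and the earlier one has lost
`ε • z`, which dominates `K⁻¹ • v n`. -/
theorem disjointification_disjoint (hv : ∀ n, 0 ≤ v n) (hz : 0 ≤ z) (hε : 0 < ε)
    (hL : ∀ n, ε ≤ L n) (hvz : ∀ n, v n ≤ L n • z) :
    Pairwise fun m n => disjointification v z L ε m ⊓ disjointification v z L ε n = 0 := by
  have hL0 : ∀ n, 0 ≤ L n := fun n => hε.le.trans (hL n)
  have key : ∀ m n, m < n →
      disjointification v z L ε m ⊓ disjointification v z L ε n = 0 := by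
    intro m n hmn
    refine posPart_smul_sub_disjoint (a := v n) (b := v m) (K := L n / ε)
      ((one_le_div hε).2 (hL n)) (disjointification_nonneg n) (disjointification_nonneg m)
      (posPart_mono ?_) (posPart_mono ?_)
    · refine (sub_le_self _ (smul_nonneg hε.le hz)).trans (sub_le_sub_left ?_ _)
      exact smul_le_smul_of_nonneg_left
        (Finset.single_le_sum (fun i _ => hv i) (Finset.mem_range.2 hmn)) (div_nonneg (hL0 n) hε.le)
    · refine sub_le_sub (sub_le_self _ ?_) ?_
      · exact smul_nonneg (div_nonneg (hL0 m) hε.le) (Finset.sum_nonneg fun i _ => hv i)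
      · have := smul_le_smul_of_nonneg_left (hvz n) (div_nonneg hε.le (hL0 n))
        rwa [smul_smul, div_mul_cancel₀ _ (hε.trans_le (hL n)).ne', ← inv_div] at this
  intro m n hmn
  rcases hmn.lt_or_gt with h | h
  · exact key m n h
  · exact (inf_comm _ _).trans (key n m h)

end NormedLattice

/-- Recursive construction of a sequence whose `n`-th term may be chosen depending on all the
previous ones. -/
theorem exists_seq_of_forall_history {α : Type*} [Nonempty α] {P : ℕ → α → Prop}
    {r : ℕ → ℕ → α → α → Prop}
    (h : ∀ (n : ℕ) (a : ℕ → α), (∀ m < n, P m (a m)) → ∃ y, P n y ∧ ∀ m < n, r m n (a m) y) :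
    ∃ a : ℕ → α, (∀ n, P n (a n)) ∧ ∀ m n, m < n → r m n (a m) (a n) := by
  let a : ℕ → α := WellFounded.fix Nat.lt_wfRel.wf fun n prev =>
    Classical.epsilon fun y => P n y ∧ ∀ m, (hm : m < n) → r m n (prev m hm) y
  have ha : ∀ n, a n = Classical.epsilon fun y => P n y ∧ ∀ m, m < n → r m n (a m) y :=
    fun n => WellFounded.fix_eq _ _ n
  have key : ∀ n, P n (a n) ∧ ∀ m, m < n → r m n (a m) (a n) := by
    intro n
    induction n using Nat.strong_induction_on with
    | _ n ih =>
      have := Classical.epsilon_spec (h n a fun m hm => (ih m hm).1)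
      rwa [← ha n] at this
  exact ⟨a, fun n => (key n).1, fun m n hmn => (key n).2 m hmn⟩

/-! ### Riesz–Kantorovich formulas and the bidual embedding -/

namespace DualLattice

section Basic

variable {F : Type*} [NormedAddCommGroup F] [NormedSpace ℝ F] [Lattice F] [IsOrderedAddMonoid F]

theorem apply_le_apply {f : StrongDual ℝ F} (hf : 0 ≤ f) {x y : F} (hxy : x ≤ y) : f x ≤ f y := by
  have := hf (y - x) (sub_nonneg.2 hxy)
  rw [map_sub] at this
  simpa using this

theorem apply_nonneg {f : StrongDual ℝ F} (hf : 0 ≤ f) {x : F} (hx : 0 ≤ x) : 0 ≤ f x := by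
  simpa using hf x hx

variable [HasSolidNorm F]

theorem inf_apply_le (f g : StrongDual ℝ F) {u v : F} (hv : 0 ≤ v) (hvu : v ≤ u) :
    (f ⊓ g) u ≤ f (u - v) + g v := by
  have h₁ : (f ⊓ g) (u - v) ≤ f (u - v) := (inf_le_left : f ⊓ g ≤ f) _ (sub_nonneg.2 hvu)
  have h₂ : (f ⊓ g) v ≤ g v := (inf_le_right : f ⊓ g ≤ g) _ hv
  have h₃ : (f ⊓ g) u = (f ⊓ g) (u - v) + (f ⊓ g) v := by rw [← map_add, sub_add_cancel]
  linarith

/-- With `inf_apply_le`, this is the Riesz–Kantorovich formula: `(f ⊓ g) u` is the infimum over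
splittings of `u`. -/
theorem exists_apply_sub_add_apply_lt (f g : StrongDual ℝ F) {u : F} (hu : 0 ≤ u) {η : ℝ}
    (hη : 0 < η) : ∃ v, 0 ≤ v ∧ v ≤ u ∧ f (u - v) + g v < (f ⊓ g) u + η := by
  by_contra! hcon
  have h₁ : (f ⊓ g) u = f u - conePos (f - g) u := by
    rw [← pos_apply _ hu]; rfl
  have h₂ : conePos (f - g) u ≤ f u - (f ⊓ g) u - η := conePos_le _ hu fun v hv hvu => by
    have := hcon v hv hvu
    rw [map_sub] at this
    rw [_root_.sub_apply]
    linarith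
  linarith

/-- The value of `|f|` at a positive vector is approximated by values of `f`. -/
theorem exists_lt_apply_of_lt_abs_apply {f : StrongDual ℝ F} {y : F} (hy : 0 ≤ y) {r : ℝ}
    (hr : r < |f| y) : ∃ z, |z| ≤ y ∧ r < f z := by
  by_contra! hcon
  have h₁ : |f| y = -f y + conePos (f - -f) y := by
    rw [← pos_apply _ hy]; rfl
  have h₂ : conePos (f - -f) y ≤ f y + r := conePos_le _ hy fun v hv hvy => by
    have h₃ : |v + v - y| ≤ y := by
      rw [abs_le']
      constructor
      · rw [sub_le_iff_le_add]; exact add_le_add hvy hvy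
      · rw [neg_sub]; exact sub_le_self _ (add_nonneg hv hv)
    have := hcon _ h₃
    rw [map_sub, map_add] at this
    rw [_root_.sub_apply, _root_.neg_apply]
    linarith
  linarith

theorem exists_lt_apply_of_lt_norm {f : StrongDual ℝ F} (hf : 0 ≤ f) {r : ℝ} (hr : r < ‖f‖) :
    ∃ x, 0 ≤ x ∧ ‖x‖ ≤ 1 ∧ r < f x := by
  obtain ⟨x, hx, hrx⟩ := f.exists_lt_apply_of_lt_opNorm hr
  refine ⟨|x|, abs_nonneg x, by rw [norm_abs_eq_norm]; exact hx.le, hrx.trans_le ?_⟩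
  have := abs_apply_le f x
  rwa [abs_of_nonneg hf] at this

theorem apply_le_norm_mul {f : StrongDual ℝ F} (x : F) {C B : ℝ} (hC : ‖f‖ ≤ C) (hB : ‖x‖ ≤ B) :
    f x ≤ C * B :=
  (le_abs_self _).trans ((f.le_opNorm x).trans
    (mul_le_mul hC hB (norm_nonneg x) ((norm_nonneg f).trans hC)))

/-- The component of `f` carried by `d⁺`, a functional of Hahn–Banach type. -/
theorem exists_le_apply_eq_posPart [IsOrderedModule ℝ F] {f : StrongDual ℝ F} (hf : 0 ≤ f) (d : F) :
    ∃ g : StrongDual ℝ F, 0 ≤ g ∧ g ≤ f ∧ g d = f d⁺ := by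
  have hN0 : ∀ x : F, 0 ≤ f x⁺ := fun x => apply_nonneg hf (posPart_nonneg x)
  have hNhom : ∀ c : ℝ, 0 < c → ∀ x : F, f (c • x)⁺ = c * f x⁺ := by
    intro c hc x
    rw [← smul_eq_mul, ← map_smul]
    congr 1
    refine le_antisymm ?_ ?_
    · exact sup_le (smul_le_smul_of_nonneg_left (le_posPart x) hc.le)
        (smul_nonneg hc.le (posPart_nonneg x))
    · have : x⁺ ≤ c⁻¹ • (c • x)⁺ := by
        refine sup_le ?_ (smul_nonneg (inv_nonneg.2 hc.le) (posPart_nonneg _))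
        have := smul_le_smul_of_nonneg_left (le_posPart (c • x)) (inv_nonneg.2 hc.le)
        rwa [smul_smul, inv_mul_cancel₀ hc.ne', one_smul] at this
      have := smul_le_smul_of_nonneg_left this hc.le
      rwa [smul_smul, mul_inv_cancel₀ hc.ne', one_smul] at this
  have hNadd : ∀ x y : F, f (x + y)⁺ ≤ f x⁺ + f y⁺ := fun x y => by
    rw [← map_add]
    exact apply_le_apply hf (sup_le (add_le_add (le_posPart x) (le_posPart y))
      (add_nonneg (posPart_nonneg x) (posPart_nonneg y)))
  -- Hahn–Banach from the line spanned by `d`, under the sublinear `x ↦ f x⁺`. For `x ≥ 0` this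
  -- majorant is `f x` at `x` and `0` at `-x`, whence `0 ≤ g ≤ f`.
  obtain ⟨g, hgd, hg⟩ : ∃ g : F →ₗ[ℝ] ℝ, g d = f d⁺ ∧ ∀ x, g x ≤ f x⁺ := by
    rcases eq_or_ne d 0 with rfl | hd
    · exact ⟨0, by simp, fun x => by simpa using hN0 x⟩
    obtain ⟨g, hg₁, hg₂⟩ := exists_extension_of_le_sublinear
      (LinearPMap.mkSpanSingleton (K := ℝ) d (f d⁺) hd) (fun x => f x⁺) hNhom hNadd (by
        rintro ⟨x, hx⟩
        obtain ⟨c, rfl⟩ := Submodule.mem_span_singleton.1 hx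
        rw [LinearPMap.mkSpanSingleton'_apply, smul_eq_mul]
        rcases le_or_gt c 0 with hc | hc
        · exact (mul_nonpos_of_nonpos_of_nonneg hc (hN0 d)).trans (hN0 _)
        · exact (hNhom c hc d).ge)
    refine ⟨g, ?_, hg₂⟩
    have h₁ := hg₁ ⟨(1 : ℝ) • d, Submodule.smul_mem _ _ (Submodule.mem_span_singleton_self d)⟩
    rw [LinearPMap.mkSpanSingleton'_apply] at h₁
    simpa using h₁
  have hle : ∀ x, 0 ≤ x → g x ≤ f x := fun x hx => by
    simpa [posPart_eq_self.2 hx] using hg x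
  have hnn : ∀ x, 0 ≤ x → 0 ≤ g x := fun x hx => by
    have := hg (-x)
    rw [posPart_eq_zero.2 (neg_nonpos.2 hx), map_zero, map_neg] at this
    linarith
  have hbound : ∀ x, ‖g x‖ ≤ ‖f‖ * ‖x‖ := by
    have habs : ∀ x, g x ≤ ‖f‖ * ‖x‖ := fun x => by
      refine (hg x).trans (apply_le_norm_mul _ le_rfl ?_)
      rw [← norm_abs_eq_norm x]
      exact norm_le_of_le (posPart_nonneg x) (sup_le (le_abs_self x) (abs_nonneg x))
    intro x
    rw [Real.norm_eq_abs, abs_le']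
    refine ⟨habs x, ?_⟩
    rw [← map_neg, ← norm_neg x]
    exact habs (-x)
  exact ⟨g.mkContinuous ‖f‖ hbound, fun x hx => by simpa using hnn x hx,
    fun x hx => by simpa using hle x hx, hgd⟩

end Basic

section Bidual

variable {F : Type*} [NormedAddCommGroup F] [NormedSpace ℝ F] [Lattice F] [IsOrderedAddMonoid F]
  [HasSolidNorm F]

local notation "J" => NormedSpace.inclusionInDoubleDual ℝ F

theorem inclusionInDoubleDual_nonneg {x : F} (hx : 0 ≤ x) : 0 ≤ J x := fun f hf => by
  simpa using apply_nonneg hf hx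

theorem abs_inclusionInDoubleDual_le (x : F) : |J x| ≤ J |x| := by
  rw [abs_le']
  constructor
  · intro f hf
    simpa using apply_le_apply hf (le_abs_self x)
  · intro f hf
    simpa using apply_le_apply hf (neg_le_abs x)

/-- The canonical embedding into the bidual preserves disjointness of positive vectors. -/
theorem inclusionInDoubleDual_inf_eq_zero [IsOrderedModule ℝ F] {x y : F} (hx : 0 ≤ x) (hy : 0 ≤ y)
    (hxy : x ⊓ y = 0) : J x ⊓ J y = 0 := by
  refine le_antisymm (fun f hf => ?_)
    (le_inf (inclusionInDoubleDual_nonneg hx) (inclusionInDoubleDual_nonneg hy))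
  -- Here `(x - y)⁺ = x`, so `g x - g y = f x`, forcing `g x = f x` and `g y = 0`. Splitting `f` as
  -- `(f - g) + g` makes both terms of the infimum formula vanish.
  obtain ⟨g, hg, hgf, hgd⟩ := exists_le_apply_eq_posPart hf (x - y)
  have hd : (x - y)⁺ = x := by
    have := inf_eq_sub_posPart_sub x y
    rw [hxy] at this
    exact (sub_eq_zero.1 this.symm).symm
  have h₁ := inf_apply_le (J x) (J y) (u := f) hg hgf
  have h₂ := apply_nonneg hg hy
  have h₃ := hgf x hx
  rw [hd, map_sub] at hgd
  simp only [NormedSpace.dual_def, _root_.sub_apply] at h₁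
  rw [_root_.zero_apply]
  linarith

theorem isDisjointSeq_inclusionInDoubleDual [IsOrderedModule ℝ F] {x : ℕ → F}
    (hx : IsDisjointSeq x) : IsDisjointSeq fun n => J (x n) := fun m n hmn =>
  inf_eq_zero_of_le (abs_nonneg _) (abs_nonneg _) (abs_inclusionInDoubleDual_le _)
    (abs_inclusionInDoubleDual_le _)
    (inclusionInDoubleDual_inf_eq_zero (abs_nonneg _) (abs_nonneg _) (hx m n hmn))

end Bidual

end DualLattice

theorem isWeaklyNull_iff {X : Type*} [NormedAddCommGroup X] [NormedSpace ℝ X] {x : ℕ → X} :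
    IsWeaklyNull x ↔ ∀ f : StrongDual ℝ X, Tendsto (fun n => f (x n)) atTop (𝓝 0) := by
  have := WeakBilin.tendsto_iff_forall_eval_tendsto (topDualPairing ℝ X).flip
    (f := fun n => toWeakSpace ℝ X (x n)) (l := atTop) (x := 0)
    (fun a b hab => (NormedSpace.eq_iff_forall_dual_eq ℝ).2 fun g => LinearMap.congr_fun hab g)
  refine this.trans (forall_congr' fun f => ?_)
  change Tendsto (fun n => f (x n)) atTop (𝓝 (f 0)) ↔ _
  rw [map_zero]

theorem isWeakStarNull_iff {X : Type*} [NormedAddCommGroup X] [NormedSpace ℝ X]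
    {f : ℕ → StrongDual ℝ X} :
    IsWeakStarNull f ↔ ∀ x : X, Tendsto (fun n => f n x) atTop (𝓝 0) :=
  tendsto_iff_forall_eval_tendsto_topDualPairing

/-! ### Extracting disjoint sequences of vectors -/

namespace DualLattice

variable {F : Type*} [NormedAddCommGroup F] [NormedSpace ℝ F] [Lattice F] [IsOrderedAddMonoid F]
  [IsOrderedModule ℝ F] [HasSolidNorm F]

theorem le_apply_disjointification {g : StrongDual ℝ F} (hg : 0 ≤ g) (v : ℕ → F) (z : F)
    (L : ℕ → ℝ) (ε : ℝ) (n : ℕ) :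
    g (v n) - L n / ε * ∑ m ∈ Finset.range n, g (v m) - ε * g z ≤
      g (disjointification v z L ε n) := by
  have := apply_le_apply hg (le_posPart (v n - (L n / ε) • ∑ m ∈ Finset.range n, v m - ε • z))
  rwa [map_sub, map_sub, map_smul, map_smul, map_sum, smul_eq_mul, smul_eq_mul] at this

/-- A disjoint sequence of positive functionals cannot stay large in the limit of an ultrafilter:
its infima with the limit functional tend to zero pointwise. -/
theorem tendsto_inf_apply_zero_of_disjoint {g : ℕ → StrongDual ℝ F} {μ : StrongDual ℝ F} {u : F}
    (hg : ∀ n, 0 ≤ g n) (hd : Pairwise fun m n => g m ⊓ g n = 0) (hμ : 0 ≤ μ) (hu : 0 ≤ u) :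
    Tendsto (fun n => (g n ⊓ μ) u) atTop (𝓝 0) := by
  have h0 : ∀ n, 0 ≤ g n ⊓ μ := fun n => le_inf (hg n) hμ
  refine (summable_of_sum_range_le (c := μ u) (fun n => apply_nonneg (h0 n) hu)
    fun n => ?_).tendsto_atTop_zero
  have := sum_range_le_of_disjoint h0
    (fun m n hmn => inf_eq_zero_of_le (h0 m) (h0 n) inf_le_left inf_le_left (hd hmn))
    (fun n => inf_le_right) n u hu
  simpa [sum_apply] using this

theorem exists_ultrafilter_limit {g : ℕ → StrongDual ℝ F} {C : ℝ} (hC : ∀ n, ‖g n‖ ≤ C)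
    (hg : ∀ n, 0 ≤ g n) (U : Ultrafilter ℕ) :
    ∃ μ : StrongDual ℝ F, 0 ≤ μ ∧ ∀ x, Tendsto (fun n => g n x) U (𝓝 (μ x)) := by
  obtain ⟨μ, -, hμ⟩ := (WeakDual.isCompact_closedBall (𝕜 := ℝ) (0 : StrongDual ℝ F)
    C).ultrafilter_le_nhds (U.map fun n => StrongDual.toWeakDual (g n)) (by
      rw [le_principal_iff]
      exact Filter.mem_map.2 (Filter.univ_mem' fun n => mem_closedBall_zero_iff.2 (hC n)))
  have hlim : ∀ x, Tendsto (fun n => g n x) U (𝓝 (WeakDual.toStrongDual μ x)) :=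
    tendsto_iff_forall_eval_tendsto_topDualPairing.1 hμ
  exact ⟨WeakDual.toStrongDual μ,
    fun x hx => ge_of_tendsto' (hlim x) fun n => apply_nonneg (hg n) hx, hlim⟩

/-- If a bounded disjoint sequence of positive functionals does not tend to zero at `u`, then it
stays away from zero along some disjoint sequence in the order interval `[0, u]`. -/
theorem exists_disjoint_le_of_frequently {g : ℕ → StrongDual ℝ F} {u : F} {C δ : ℝ}
    (hg : ∀ n, 0 ≤ g n) (hd : Pairwise fun m n => g m ⊓ g n = 0) (hC : ∀ n, ‖g n‖ ≤ C)
    (hu : 0 ≤ u) (hδ : 0 < δ) (hfreq : ∃ᶠ n in atTop, δ ≤ g n u) :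
    ∃ φ : ℕ → ℕ, StrictMono φ ∧ ∃ y : ℕ → F, (∀ k, 0 ≤ y k) ∧ (∀ k, y k ≤ u) ∧
      (Pairwise fun j k => y j ⊓ y k = 0) ∧ ∀ k, δ / 2 ≤ g (φ k) (y k) := by
  have hne : (atTop ⊓ 𝓟 {n | δ ≤ g n u}).NeBot := frequently_mem_iff_neBot.1 hfreq
  -- The ultrafilter supplies a weak-* limit `μ` where a convergent subsequence may not exist.
  let U : Ultrafilter ℕ := Ultrafilter.of (atTop ⊓ 𝓟 {n | δ ≤ g n u})
  have hU : (U : Filter ℕ) ≤ atTop := (Ultrafilter.of_le _).trans inf_le_left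
  have hUδ : ∀ᶠ n in U, δ ≤ g n u :=
    ((Ultrafilter.of_le _).trans inf_le_right : (U : Filter ℕ) ≤ _) (mem_principal_self _)
  obtain ⟨μ, hμ0, hμ⟩ := exists_ultrafilter_limit hC hg U
  have hC0 : 0 ≤ C := (norm_nonneg _).trans (hC 0)
  have hM : 0 < C * ‖u‖ + 1 := by positivity
  obtain ⟨ε, hε, hε1, hεM⟩ : ∃ ε : ℝ, 0 < ε ∧ ε ≤ 1 ∧ ε * (C * ‖u‖ + 1) ≤ δ / 8 :=
    ⟨min 1 (δ / 8 / (C * ‖u‖ + 1)), lt_min one_pos (by positivity), min_le_left _ _,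
      (le_div_iff₀ hM).1 (min_le_right _ _)⟩
  -- Since `(g i ⊓ μ) u` is tiny, some `v` in `[0, u]` carries nearly all of `g i u` while `μ v` is
  -- tiny. Later functionals are chosen close to `μ` at `v`, hence tiny there. The weights `(1 / 2)
  -- ^ m` make the sum over earlier terms at most `ε * δ / 8`; the three losses are at most `δ / 8`
  -- each.
  obtain ⟨a, haP, har⟩ := exists_seq_of_forall_history (α := ℕ × F)
    (P := fun k a => 0 ≤ a.2 ∧ a.2 ≤ u ∧ δ ≤ g a.1 u ∧ g a.1 (u - a.2) < δ / 8 ∧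
      μ a.2 < ε * δ / 16 * (1 / 2) ^ k)
    (r := fun m _ a b => a.1 < b.1 ∧ g b.1 a.2 < ε * δ / 16 * (1 / 2) ^ m) (by
      intro n a ha
      have h₁ : ∀ᶠ i in U, ∀ m ∈ Finset.range n,
          (a m).1 < i ∧ g i (a m).2 < ε * δ / 16 * (1 / 2) ^ m := by
        rw [Filter.eventually_all_finset]
        intro m hm
        exact ((eventually_gt_atTop (a m).1).filter_mono hU).and ((hμ (a m).2).eventually_lt_const
          (ha m (Finset.mem_range.1 hm)).2.2.2.2)
      obtain ⟨η, hη, hη₁, hη₂⟩ : ∃ η : ℝ, 0 < η ∧ η ≤ δ / 16 ∧ η ≤ ε * δ / 32 * (1 / 2) ^ n :=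
        ⟨min (δ / 16) (ε * δ / 32 * (1 / 2) ^ n), lt_min (by positivity) (by positivity),
          min_le_left _ _, min_le_right _ _⟩
      have h₂ : ∀ᶠ i in U, (g i ⊓ μ) u < η :=
        hU ((tendsto_inf_apply_zero_of_disjoint hg hd hμ0 hu).eventually_lt_const hη)
      obtain ⟨i, hi₁, hi₂, hi₃⟩ := (h₁.and (h₂.and hUδ)).exists
      obtain ⟨v, hv, hvu, hlt⟩ := exists_apply_sub_add_apply_lt (g i) μ hu hη
      have h₃ := apply_nonneg (hg i) (sub_nonneg.2 hvu)
      have h₄ := apply_nonneg hμ0 hv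
      exact ⟨(i, v), ⟨hv, hvu, hi₃, by dsimp only; linarith, by dsimp only; linarith⟩,
        fun m hm => hi₁ m (Finset.mem_range.2 hm)⟩)
  have hv : ∀ n, 0 ≤ (a n).2 := fun n => (haP n).1
  refine ⟨fun k => (a k).1, fun m n hmn => (har m n hmn).1,
    disjointification (fun k => (a k).2) u (fun _ => 1) ε, disjointification_nonneg,
    fun k => (disjointification_le hv hu (fun _ => zero_le_one) hε.le k).trans (haP k).2.1,
    disjointification_disjoint hv hu hε (fun _ => hε1) fun n => by
      simpa using (haP n).2.1, fun k => ?_⟩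
  refine le_trans ?_ (le_apply_disjointification (hg _) _ _ _ _ k)
  obtain ⟨-, -, h₁, h₂, -⟩ := haP k
  rw [map_sub] at h₂
  have h₃ : ∑ m ∈ Finset.range k, g (a k).1 (a m).2 ≤ ε * δ / 8 := by
    calc ∑ m ∈ Finset.range k, g (a k).1 (a m).2
        ≤ ∑ m ∈ Finset.range k, ε * δ / 16 * (1 / 2) ^ m :=
          Finset.sum_le_sum fun m hm => (har m k (Finset.mem_range.1 hm)).2.le
      _ = ε * δ / 16 * ∑ m ∈ Finset.range k, (1 / 2) ^ m := by rw [Finset.mul_sum]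
      _ ≤ ε * δ / 16 * 2 := mul_le_mul_of_nonneg_left (sum_geometric_two_le k) (by positivity)
      _ = ε * δ / 8 := by ring
  have h₄ : 1 / ε * ∑ m ∈ Finset.range k, g (a k).1 (a m).2 ≤ δ / 8 := by
    rw [one_div_mul_eq_div, div_le_iff₀ hε]
    linarith
  have h₅ : ε * g (a k).1 u ≤ δ / 8 := by
    refine (mul_le_mul_of_nonneg_left ?_ hε.le).trans hεM
    exact (apply_le_norm_mul u (hC _) le_rfl).trans (le_add_of_nonneg_right zero_le_one)
  linarith

/-- If bounded positive functionals tend to zero at each term of a bounded sequence `x` of positive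
vectors but `g n (x n)` stays away from zero, then along a subsequence `x` can be replaced by a
disjoint sequence of smaller vectors. -/
theorem exists_disjoint_le_of_tendsto_zero [CompleteSpace F] {g : ℕ → StrongDual ℝ F} {x : ℕ → F}
    {B C δ : ℝ} (hg : ∀ n, 0 ≤ g n) (hC : ∀ n, ‖g n‖ ≤ C) (hx : ∀ n, 0 ≤ x n)
    (hB : ∀ n, ‖x n‖ ≤ B) (hδ : 0 < δ) (hlim : ∀ m, Tendsto (fun n => g n (x m)) atTop (𝓝 0))
    (hgx : ∀ n, δ ≤ g n (x n)) :
    ∃ φ : ℕ → ℕ, StrictMono φ ∧ ∃ y : ℕ → F, (∀ k, 0 ≤ y k) ∧ (∀ k, y k ≤ x (φ k)) ∧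
      (Pairwise fun j k => y j ⊓ y k = 0) ∧ ∀ k, δ / 2 ≤ g (φ k) (y k) := by
  have hC0 : 0 ≤ C := (norm_nonneg _).trans (hC 0)
  have hB0 : 0 ≤ B := (norm_nonneg _).trans (hB 0)
  have hM : 0 < C * (2 * B) + 1 := by positivity
  obtain ⟨ε, hε, hε1, hεM⟩ : ∃ ε : ℝ, 0 < ε ∧ ε ≤ 1 ∧ ε * (C * (2 * B) + 1) ≤ δ / 8 :=
    ⟨min 1 (δ / 8 / (C * (2 * B) + 1)), lt_min one_pos (by positivity), min_le_left _ _,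
      (le_div_iff₀ hM).1 (min_le_right _ _)⟩
  -- The factor `n + 1` absorbs the number of earlier terms, `2 ^ n / ε` is the multiple of them cut
  -- off later.
  obtain ⟨φ, -, hφ⟩ := exists_seq_of_forall_history (α := ℕ) (P := fun _ _ => True)
    (r := fun _ n i j => i < j ∧ g j (x i) < ε * δ / (8 * (n + 1) * 2 ^ n)) (by
      intro n a _
      have h₁ : ∀ᶠ j in atTop, ∀ m ∈ Finset.range n,
          a m < j ∧ g j (x (a m)) < ε * δ / (8 * (n + 1) * 2 ^ n) := by
        rw [Filter.eventually_all_finset]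
        intro m _
        exact (eventually_gt_atTop _).and ((hlim (a m)).eventually_lt_const (by positivity))
      obtain ⟨j, hj⟩ := h₁.exists
      exact ⟨j, trivial, fun m hm => hj m (Finset.mem_range.2 hm)⟩)
  have hbound : ∀ i, ‖(1 / 2 : ℝ) ^ i • x (φ i)‖ ≤ (1 / 2) ^ i * B := fun i => by
    rw [norm_smul, Real.norm_of_nonneg (by positivity)]
    exact mul_le_mul_of_nonneg_left (hB _) (by positivity)
  have hsum := (hasSum_geometric_two.mul_right B)
  have hs : Summable fun i => (1 / 2 : ℝ) ^ i • x (φ i) :=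
    Summable.of_norm_bounded hsum.summable hbound
  have hnn : ∀ i, 0 ≤ (1 / 2 : ℝ) ^ i • x (φ i) := fun i => smul_nonneg (by positivity) (hx _)
  -- Completeness yields one control vector with `x (φ n) ≤ 2 ^ n • z`.
  obtain ⟨z, hz⟩ : ∃ z, z = ∑' i, (1 / 2 : ℝ) ^ i • x (φ i) := ⟨_, rfl⟩
  have hz0 : 0 ≤ z := hz ▸ tsum_nonneg hnn
  have hzB : ‖z‖ ≤ 2 * B := hz ▸ tsum_of_norm_bounded hsum hbound
  have hxz : ∀ n, x (φ n) ≤ (2 : ℝ) ^ n • z := fun n => by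
    have h₁ : (1 / 2 : ℝ) ^ n • x (φ n) ≤ z := hz ▸ hs.le_tsum n fun i _ => hnn i
    have h₂ := smul_le_smul_of_nonneg_left h₁ (by positivity : (0 : ℝ) ≤ 2 ^ n)
    rwa [smul_smul, ← mul_pow, mul_one_div_cancel two_ne_zero, one_pow, one_smul] at h₂
  refine ⟨φ, fun m n hmn => (hφ m n hmn).1,
    disjointification (fun k => x (φ k)) z (fun n => 2 ^ n) ε, disjointification_nonneg,
    disjointification_le (fun n => hx _) hz0 (fun n => by positivity) hε.le,
    disjointification_disjoint (fun n => hx _) hz0 hε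
      (fun n => hε1.trans (one_le_pow₀ one_le_two)) hxz, fun k => ?_⟩
  refine le_trans ?_ (le_apply_disjointification (hg _) _ _ _ _ k)
  have h₁ := hgx (φ k)
  have h₃ : ∑ m ∈ Finset.range k, g (φ k) (x (φ m)) ≤ k * (ε * δ / (8 * (k + 1) * 2 ^ k)) := by
    refine (Finset.sum_le_sum fun m hm => (hφ m k (Finset.mem_range.1 hm)).2.le).trans ?_
    rw [Finset.sum_const, Finset.card_range, nsmul_eq_mul]
  have h₄ : 2 ^ k / ε * ∑ m ∈ Finset.range k, g (φ k) (x (φ m)) ≤ δ / 8 := by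
    calc 2 ^ k / ε * ∑ m ∈ Finset.range k, g (φ k) (x (φ m))
        ≤ 2 ^ k / ε * ((k + 1) * (ε * δ / (8 * (k + 1) * 2 ^ k))) := by
          refine mul_le_mul_of_nonneg_left (h₃.trans ?_) (by positivity)
          exact mul_le_mul_of_nonneg_right (le_add_of_nonneg_right zero_le_one) (by positivity)
      _ = δ / 8 := by field_simp
  have h₅ : ε * g (φ k) z ≤ δ / 8 := by
    refine (mul_le_mul_of_nonneg_left ?_ hε.le).trans hεM
    exact (apply_le_norm_mul z (hC _) hzB).trans (le_add_of_nonneg_right zero_le_one)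
  linarith

end DualLattice

theorem exists_frequently_le_of_not_tendsto_zero {r : ℕ → ℝ} (hr : ∀ n, 0 ≤ r n)
    (h : ¬Tendsto r atTop (𝓝 0)) : ∃ δ, 0 < δ ∧ ∃ᶠ n in atTop, δ ≤ r n := by
  by_contra! hcon
  refine h ((tendsto_order.2 ⟨fun a ha => .of_forall fun n => ha.trans_le (hr n), fun a ha => ?_⟩))
  simpa [not_frequently] using hcon a ha

/-! ### Bounded disjoint sequences and weak convergence -/

namespace DualLattice

section Sequences

variable {F : Type*} [NormedAddCommGroup F] [NormedSpace ℝ F] [Lattice F] [IsOrderedAddMonoid F]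
  [IsOrderedModule ℝ F] [HasSolidNorm F]

/-- On a normed lattice with order continuous norm, bounded disjoint sequences of positive
functionals are weak-* null. -/
theorem tendsto_apply_zero_of_disjoint (h : HasOrderContinuousNorm F) {g : ℕ → StrongDual ℝ F}
    {C : ℝ} (hg : ∀ n, 0 ≤ g n) (hd : Pairwise fun m n => g m ⊓ g n = 0) (hC : ∀ n, ‖g n‖ ≤ C)
    {u : F} (hu : 0 ≤ u) : Tendsto (fun n => g n u) atTop (𝓝 0) := by
  by_contra hcon
  obtain ⟨δ, hδ, hfreq⟩ :=
    exists_frequently_le_of_not_tendsto_zero (fun n => apply_nonneg (hg n) hu) hcon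
  obtain ⟨φ, -, y, hy0, hyu, hyd, hy⟩ := exists_disjoint_le_of_frequently hg hd hC hu hδ hfreq
  have h₁ : Tendsto (fun k => C * ‖y k‖) atTop (𝓝 0) := by
    simpa using (h.tendsto_zero_of_disjoint hy0 hyd hyu).norm.const_mul C
  obtain ⟨k, hk⟩ := (h₁.eventually_lt_const (half_pos hδ)).exists
  exact (((hy k).trans (apply_le_norm_mul (y k) (hC _) le_rfl)).trans_lt hk).false

/-- A bounded disjoint sequence of positive functionals that stays away from zero in norm does so
along a bounded disjoint sequence of vectors. -/
theorem exists_disjoint_of_le_norm [CompleteSpace F] {g : ℕ → StrongDual ℝ F} {C δ : ℝ}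
    (hg : ∀ n, 0 ≤ g n) (hd : Pairwise fun m n => g m ⊓ g n = 0) (hC : ∀ n, ‖g n‖ ≤ C)
    (hδ : 0 < δ) (hgδ : ∀ n, δ ≤ ‖g n‖) :
    ∃ φ : ℕ → ℕ, StrictMono φ ∧ ∃ (y : ℕ → F) (B r : ℝ), (∀ k, 0 ≤ y k) ∧ (∀ k, ‖y k‖ ≤ B) ∧
      (Pairwise fun j k => y j ⊓ y k = 0) ∧ 0 < r ∧ ∀ k, r ≤ g (φ k) (y k) := by
  choose x hx0 hx1 hgx using fun n =>
    exists_lt_apply_of_lt_norm (hg n) ((half_lt_self hδ).trans_le (hgδ n))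
  -- Either `g` tends to zero at each nearly norming vector, and these can be made disjoint, or it
  -- stays large at one `x m`, and a disjoint sequence exists in `[0, x m]`.
  by_cases hlim : ∀ m, Tendsto (fun n => g n (x m)) atTop (𝓝 0)
  · obtain ⟨φ, hφ, y, hy0, hyx, hyd, hy⟩ := exists_disjoint_le_of_tendsto_zero hg hC hx0 hx1
      (half_pos hδ) hlim fun n => (hgx n).le
    exact ⟨φ, hφ, y, 1, _, hy0, fun k => (norm_le_of_le (hy0 k) (hyx k)).trans (hx1 _), hyd,
      half_pos (half_pos hδ), hy⟩
  · push Not at hlim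
    obtain ⟨m, hm⟩ := hlim
    obtain ⟨r, hr, hfreq⟩ :=
      exists_frequently_le_of_not_tendsto_zero (fun n => apply_nonneg (hg n) (hx0 m)) hm
    obtain ⟨φ, hφ, y, hy0, hyu, hyd, hy⟩ :=
      exists_disjoint_le_of_frequently hg hd hC (hx0 m) hr hfreq
    exact ⟨φ, hφ, y, ‖x m‖, _, hy0, fun k => norm_le_of_le (hy0 k) (hyu k), hyd, half_pos hr, hy⟩

/-- If the dual norm is order continuous, bounded disjoint sequences are weakly null. -/
theorem isWeaklyNull_of_disjoint (h : HasOrderContinuousNorm (StrongDual ℝ F)) {x : ℕ → F} {B : ℝ}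
    (hx : IsDisjointSeq x) (hB : ∀ n, ‖x n‖ ≤ B) : IsWeaklyNull x := by
  rw [isWeaklyNull_iff]
  intro f
  have h₁ := tendsto_apply_zero_of_disjoint h (C := B)
    (g := fun n => NormedSpace.inclusionInDoubleDual ℝ F |x n|)
    (fun n => inclusionInDoubleDual_nonneg (abs_nonneg _))
    (fun m n hmn => inclusionInDoubleDual_inf_eq_zero (abs_nonneg _) (abs_nonneg _) (hx m n hmn))
    (fun n => (NormedSpace.double_dual_bound ℝ F _).trans (by
      rw [norm_abs_eq_norm]; exact hB n)) (abs_nonneg f)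
  exact squeeze_zero_norm (fun n => abs_apply_le f (x n)) h₁

end Sequences

end DualLattice

/-! ### The three classes of sets -/

section Classes

open DualLattice

theorem exists_subseq_of_not_tendstoUniformlyOn_zero {α : Type*} {φ : ℕ → α → ℝ} {A : Set α}
    (h : ¬TendstoUniformlyOn φ 0 atTop A) :
    ∃ ε, 0 < ε ∧ ∃ θ : ℕ → ℕ, StrictMono θ ∧ ∀ k, ∃ a ∈ A, ε ≤ |φ (θ k) a| := by
  rw [Metric.tendstoUniformlyOn_iff] at h
  push Not at h
  obtain ⟨ε, hε, hfreq⟩ := h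
  obtain ⟨θ, hθ, hθA⟩ := extraction_of_frequently_atTop hfreq
  refine ⟨ε, hε, θ, hθ, fun k => ?_⟩
  obtain ⟨a, ha, hle⟩ := hθA k
  exact ⟨a, ha, by simpa [Real.dist_eq] using hle⟩

variable {F : Type*} [NormedAddCommGroup F] [NormedSpace ℝ F] [Lattice F] [IsOrderedAddMonoid F]
  [HasSolidNorm F]

theorem IsAlmostLimited.isAlmostDunfordPettis {A : Set F} (hA : IsAlmostLimited A) :
    IsAlmostDunfordPettis A :=
  ⟨hA.1, fun f hf hf0 => hA.2 f hf (isWeakStarNull_iff.2 fun x =>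
    isWeaklyNull_iff.1 hf0 (NormedSpace.inclusionInDoubleDual ℝ F x))⟩

variable [IsOrderedModule ℝ F]

theorem IsAlmostDunfordPettis.isAlmostLSet {A : Set (StrongDual ℝ F)}
    (hA : IsAlmostDunfordPettis A) : IsAlmostLSet A := by
  refine ⟨hA.1, fun x hx hx0 => ?_⟩
  refine hA.2 (fun n => NormedSpace.inclusionInDoubleDual ℝ F (x n))
    (isDisjointSeq_inclusionInDoubleDual hx) (isWeaklyNull_iff.2 fun Φ => ?_)
  exact isWeaklyNull_iff.1 hx0 (Φ.comp (NormedSpace.inclusionInDoubleDual ℝ F))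

/-- If the dual norm is order continuous, no disjoint sequence in the solid hull of an almost
L-set stays away from zero in norm. -/
theorem IsAlmostLSet.not_forall_le_norm [CompleteSpace F] {A : Set (StrongDual ℝ F)}
    (hA : IsAlmostLSet A) (hF : HasOrderContinuousNorm (StrongDual ℝ F))
    {f g : ℕ → StrongDual ℝ F} (hf : ∀ n, f n ∈ A) (hg : ∀ n, 0 ≤ g n) (hgf : ∀ n, g n ≤ |f n|)
    (hd : Pairwise fun m n => g m ⊓ g n = 0) {δ : ℝ} (hδ : 0 < δ) : ¬∀ n, δ ≤ ‖g n‖ := by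
  intro hgδ
  obtain ⟨C, hC⟩ := hA.1.exists_norm_le
  obtain ⟨φ, -, y, B, r, hy0, hyB, hyd, hr, hgy⟩ := exists_disjoint_of_le_norm hg hd
    (fun n => (norm_le_of_le (hg n) (hgf n)).trans ((norm_abs_eq_norm _).trans_le (hC _ (hf n))))
    hδ hgδ
  -- The L-set property concerns `f`, not `|f|`; passing to `|z k| ≤ y k` recovers values of `f` and
  -- keeps disjointness.
  choose z hzy hfz using fun k => exists_lt_apply_of_lt_abs_apply (f := f (φ k)) (hy0 k)
    ((half_lt_self hr).trans_le ((hgy k).trans (hgf _ _ (hy0 k))))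
  have hzy' : ∀ k, |z k| ≤ |y k| := fun k => (hzy k).trans (le_abs_self _)
  have hz : IsDisjointSeq z := (isDisjointSeq_of_nonneg hy0 hyd).of_abs_le hzy'
  have hz0 := hA.2 z hz (isWeaklyNull_of_disjoint hF hz fun k =>
    (norm_le_norm_of_abs_le_abs (hzy' k)).trans (hyB k))
  obtain ⟨k, hk⟩ := (Metric.tendstoUniformlyOn_iff.1 hz0 _ (half_pos hr)).exists
  have h₁ := hk (f (φ k)) (hf _)
  simp only [Pi.zero_apply, dist_zero_left, Real.norm_eq_abs] at h₁
  exact ((hfz k).trans_le (le_abs_self _)).not_gt h₁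

theorem IsAlmostLSet.isAlmostLimited [CompleteSpace F] {A : Set (StrongDual ℝ F)}
    (hA : IsAlmostLSet A) (hF : HasOrderContinuousNorm (StrongDual ℝ F)) : IsAlmostLimited A := by
  refine ⟨hA.1, fun φ hφ hφ0 => ?_⟩
  by_contra hcon
  obtain ⟨ε, hε, θ, hθ, hθA⟩ := exists_subseq_of_not_tendstoUniformlyOn_zero hcon
  choose f hfA hf using hθA
  obtain ⟨B, hB⟩ := hA.1.exists_norm_le
  obtain ⟨C, hC⟩ := banach_steinhaus (g := φ) fun x => by
    obtain ⟨c, hc⟩ := (Metric.isBounded_range_of_tendsto _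
      (isWeakStarNull_iff.1 hφ0 x)).exists_norm_le
    exact ⟨c, fun n => hc _ ⟨n, rfl⟩⟩
  have hCabs : ∀ k, ‖|φ (θ k)|‖ ≤ C := fun k => (norm_abs_eq_norm _).trans_le (hC _)
  have hd : Pairwise fun j k => |φ (θ j)| ⊓ |φ (θ k)| = 0 := fun j k hjk =>
    hφ _ _ (hθ.injective.ne hjk)
  obtain ⟨ψ, -, g, hg0, hgf, hgd, hg⟩ := exists_disjoint_le_of_tendsto_zero
    (g := fun k => |φ (θ k)|) (x := fun k => |f k|) (B := B) (fun k => abs_nonneg _) hCabs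
    (fun k => abs_nonneg _) (fun k => (norm_abs_eq_norm _).trans_le (hB _ (hfA k))) hε
    (fun m => tendsto_apply_zero_of_disjoint hF (fun k => abs_nonneg _) hd hCabs (abs_nonneg _))
    fun k => (hf k).trans (abs_apply_le _ _)
  have hC0 : 0 ≤ C := (norm_nonneg _).trans (hC 0)
  -- The bound is `ε / 2 ≤ |φ| (g k) ≤ (C + 1) * ‖g k‖`; the `+ 1` keeps the divisor positive.
  refine hA.not_forall_le_norm hF (f := fun k => f (ψ k)) (fun k => hfA _) hg0 hgf hgd
    (δ := ε / 2 / (C + 1)) (by positivity) fun k => ?_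
  rw [div_le_iff₀' (by positivity)]
  exact (hg k).trans (apply_le_norm_mul _ ((hCabs _).trans (le_add_of_nonneg_right zero_le_one))
    le_rfl)

end Classes

theorem theorem2p8 {E : Type*} [NormedAddCommGroup E] [NormedSpace ℝ E] [CompleteSpace E]
    [Lattice E] [IsOrderedAddMonoid E] [IsOrderedModule ℝ E] [HasSolidNorm E]
    (hE : HasOrderContinuousNorm (StrongDual ℝ E)) (A : Set (StrongDual ℝ E)) :
    (IsAlmostLimited A ↔ IsAlmostDunfordPettis A) ∧
      (IsAlmostDunfordPettis A ↔ IsAlmostLSet A) :=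
  ⟨⟨fun h => h.isAlmostDunfordPettis, fun h => h.isAlmostLSet.isAlmostLimited hE⟩,
    ⟨fun h => h.isAlmostLSet, fun h => (h.isAlmostLimited hE).isAlmostDunfordPettis⟩⟩
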